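/- Let $\mathcal X_1,\mathcal X_2$ be real Banach spaces, $\mathcal X_2\neq\{0\}$, and let $\mathcal C_i\subset\mathcal X_i$ be closed convex pointed cones ($\mathcal C_i\cap(-\mathcal C_i)=\{0\}$) that are normal (there is $K>0$ such that $0\le x\le y$ implies $\|x\|\le K\|y\|$, where $x\le y$ means $y-x\in\mathcal C_i$) and have nonempty interiors $\mathcal C_i^0$; fix $\mathbf e_i\in\mathcal C_i^0$. Notation. For a cone $\mathcal C$ with its order put $M(x/y)=\inf\{t\in\mathbb R: x\le ty\}$ and $m(x/y)=\sup\{t\in\mathbb R: ty\le x\}$ (with $\inf\emptyset=+\infty$), and for nonzero $x,y\in\mathcal C$ let $d_H(x,y)=\log\big(M(x/y)/m(x/y)\big)\in[0,\infty]$, read as $+\infty$ when $M(x/y)=\infty$ or $m(x/y)=0$. With respect to a unit $\mathbf e\in\mathcal C^0$ put $\|x\|_T=\max(M(x/\mathbf e),-m(x/\mathbf e))$ and $\|x\|_H=M(x/\mathbf e)-m(x/\mathbf e)$; for a continuous linear functional $\mu$ put $\|\mu\|_T^\star=\sup_{\|x\|_T=1}\langle\mu,x\rangle$, and if $\langle\mu,\mathbf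 e\rangle=0$ put $\|\mu\|_H^\star=\tfrac12\|\mu\|_T^\star$. Let $\mathcal C^\star=\{\mu:\langle\mu,x\rangle\ge0\ \forall x\in\mathcal C\}$ be the dual cone; $d_H$ between functionals is taken with respect to the order of the dual cone. Let $T:\mathcal X_1\to\mathcal X_2$ be a bounded linear map with $T(\mathbf e_1)=\lambda\mathbf e_2$ for some $\lambda\in\mathbb R$ and $T(\mathcal C_1^0)\subset\mathcal C_2^0$, and let $T^\star\mu=\mu\circ T$ be its adjoint. Put $$\|T\|_H=\sup_{\|x\|_H\le1}\|T(x)\|_H,\qquad \|T^\star\|_H^\star=\sup\{\|T^\star(\mu)\|_H^\star:\ \langle\mu,\mathbf e_2\rangle=0,\ \|\mu\|_H^\star\le1\},$$ $$\operatorname{diam}T=\sup_{x,y\in\mathcal C_1^0}d_H(T(x),T(y)),\qquad \operatorname{diam}T^\star=\sup_{u,v\in\mathcal C_2^\star\setminus\{0\}}d_H(T^\star(u),T^\star(v)).$$ Then, with $\tanh(+\infty)=1$, $$\|T^\star\|_H^\star=\|T\|_H\le\lambda\tanh\Big(\frac{\operatorname{diam}T}{4}\Big)=\lambda\tanh\Big(\frac{\operatorname{diam}T^\star}{4}\Big),$$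 and $\tanh(\operatorname{diam}T/4)=\tanh(\operatorname{diam}T^\star/4)$. In particular, if $T(\mathbf e_1)=\mathbf e_2$, then $\|T^\star\|_H^\star=\|T\|_H\le\tanh(\operatorname{diam}T/4)=\tanh(\operatorname{diam}T^\star/4)$. -/

import Mathlib

namespace HopfContraction

noncomputable section

section Ratios

variable {V : Type*} [AddCommGroup V] [Module ℝ V]

/-- `M(x/y) = inf {t ∈ ℝ : x ≤ t y}` for the order of the cone `C`, as an extended real
(the infimum of the empty set is `+∞`). -/
def upperRatio (C : Set V) (x y : V) : EReal :=
  ⨅ (t : ℝ) (_ : t • y - x ∈ C), (t : EReal)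

/-- `m(x/y) = sup {t ∈ ℝ : t y ≤ x}` for the order of the cone `C`, as an extended real. -/
def lowerRatio (C : Set V) (x y : V) : EReal :=
  ⨆ (t : ℝ) (_ : x - t • y ∈ C), (t : EReal)

/-- Hilbert's projective metric `d_H(x, y) = log (M(x/y) / m(x/y))`, for nonzero `x, y` in the
cone `C`. There `0 < M(x/y) ≤ ∞` and `0 ≤ m(x/y) < ∞`, and the value is `+∞` when
`M(x/y) = ∞` or `m(x/y) = 0`. -/
def hilbertDist (C : Set V) (x y : V) : EReal :=
  ENNReal.log ((upperRatio C x y).toENNReal / (lowerRatio C x y).toENNReal)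

/-- Thompson's norm `‖x‖_T = max (M(x/e), -m(x/e))`; both ratios are finite when `e` is an
interior point of the cone. -/
def thompsonNorm (C : Set V) (e x : V) : ℝ :=
  max (upperRatio C x e).toReal (-(lowerRatio C x e).toReal)

/-- Hopf's oscillation seminorm `‖x‖_H = M(x/e) - m(x/e)`. -/
def hopfSeminorm (C : Set V) (e x : V) : ℝ :=
  (upperRatio C x e).toReal - (lowerRatio C x e).toReal

end Ratios

section Spaces

variable {X : Type*} [NormedAddCommGroup X] [NormedSpace ℝ X]
variable {Y : Type*} [NormedAddCommGroup Y] [NormedSpace ℝ Y]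

/-- The cone is normal: there is `K > 0` such that `0 ≤ x ≤ y` implies `‖x‖ ≤ K ‖y‖`. -/
def IsNormalCone (C : Set X) : Prop :=
  ∃ K : ℝ, 0 < K ∧ ∀ x y : X, x ∈ C → y - x ∈ C → ‖x‖ ≤ K * ‖y‖

/-- The dual cone, in the space of continuous linear functionals. -/
def dualCone (C : Set X) : Set (StrongDual ℝ X) :=
  {μ | ∀ x ∈ C, 0 ≤ μ x}

/-- The dual of Thompson's norm, `‖μ‖_T^* = sup {⟨μ, x⟩ : ‖x‖_T = 1}`. -/
def dualThompsonNorm (C : Set X) (e : X) (μ : StrongDual ℝ X) : EReal :=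
  ⨆ (x : X) (_ : thompsonNorm C e x = 1), ((μ x : ℝ) : EReal)

/-- The dual of Hopf's seminorm on the functionals vanishing at `e`: `‖μ‖_H^* = ‖μ‖_T^* / 2`. -/
def dualHopfNorm (C : Set X) (e : X) (μ : StrongDual ℝ X) : EReal :=
  dualThompsonNorm C e μ / 2

/-- `‖T‖_H`, the supremum of `‖T x‖_H` over `‖x‖_H ≤ 1`. -/
def hopfOpNorm (C : Set X) (e : X) (D : Set Y) (f : Y) (T : X →L[ℝ] Y) : EReal :=
  ⨆ (x : X) (_ : hopfSeminorm C e x ≤ 1), ((hopfSeminorm D f (T x) : ℝ) : EReal)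

/-- The adjoint `T^* μ = μ ∘ T`. -/
def adjointMap (T : X →L[ℝ] Y) (μ : StrongDual ℝ Y) : StrongDual ℝ X := μ.comp T

/-- `‖T^*‖_H^*`, the supremum of `‖T^* μ‖_H^*` over the functionals `μ` with `⟨μ, f⟩ = 0` and
`‖μ‖_H^* ≤ 1`. -/
def dualHopfOpNorm (C : Set X) (e : X) (D : Set Y) (f : Y) (T : X →L[ℝ] Y) : EReal :=
  ⨆ (μ : StrongDual ℝ Y) (_ : μ f = 0 ∧ dualHopfNorm D f μ ≤ 1),
    dualHopfNorm C e (adjointMap T μ)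

/-- The projective diameter `diam T = sup {d_H(T x, T y) : x, y ∈ C⁰}`. -/
def projDiam (C : Set X) (D : Set Y) (T : X →L[ℝ] Y) : EReal :=
  ⨆ (x : X) (_ : x ∈ interior C) (y : X) (_ : y ∈ interior C), hilbertDist D (T x) (T y)

/-- The projective diameter of the adjoint,
`diam T^* = sup {d_H(T^* u, T^* v) : u, v ∈ D^* \ {0}}`, with `d_H` relative to `C^*`. -/
def dualProjDiam (C : Set X) (D : Set Y) (T : X →L[ℝ] Y) : EReal :=
  ⨆ (u : StrongDual ℝ Y) (_ : u ∈ dualCone D \ {0})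
    (v : StrongDual ℝ Y) (_ : v ∈ dualCone D \ {0}),
    hilbertDist (dualCone C) (adjointMap T u) (adjointMap T v)

end Spaces

/-- The hyperbolic tangent on the extended reals, with `tanh (± ∞) = ± 1`. -/
def tanhExt (x : EReal) : ℝ :=
  if x = ⊤ then 1 else if x = ⊥ then -1 else Real.tanh x.toReal

end

end HopfContraction

/-!
Everything is tested against states, that is, positive functionals normalized at the unit. By the
Hahn–Banach theorem a point lies in a closed cone exactly when all states are nonnegative on it
(`mem_iff_forall_states`), so `M(x/e)` and `m(x/e)` are the supremum and the infimum of the values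
of the states at `x`, and `‖x‖_H` is the largest difference between the values of two states
(`hopfSeminorm_le_iff`).

Equality of the operator norms: on functionals vanishing at the unit, `‖·‖_H^*` is the norm dual to
`‖·‖_H` (`dualHopfNorm_eq_iSup`), and differences of two states lie in its unit ball
(`dualHopfNorm_sub_le_one`). Hence both operator norms are the supremum of `μ (T x)` over the two
unit balls.

Equality of the diameters: when a cone is cut out by a family of functionals `φ i`, the inequality
`d_H(x, y) ≤ r` means `φ i x * φ j y ≤ exp r * (φ j x * φ i y)` for all `i, j`
(`hilbertDist_le_iff`). For `T` the functionals are the elements of the dual cone, for the adjoint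
they are the evaluations at points of the cone, and both `diam T ≤ r` and `diam T^* ≤ r` become the
same bound on the cross ratios of the pairing `(u, x) ↦ u (T x)`.

The contraction bound: a vector with `‖x‖_H ≤ 1` may be translated along the unit into the order
interval `[0, e₁]`. The cross ratio bound at `x` and `e₁ - x`, for two states with values
`lam * s` and `lam * t` at `T x`, reads `s (1 - t) ≤ exp r * (t (1 - s))`, which forces
`s - t ≤ tanh (r / 4)` (`sub_le_tanh_of_crossRatio`).
-/

namespace HopfContraction

/-! ### Hilbert's metric and cross ratios -/

section Ratios

variable {V : Type*} [AddCommGroup V] [Module ℝ V] {C : Set V}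

theorem apply_le_of_upperRatio_eq {φ : V →ₗ[ℝ] ℝ} (hφ : ∀ z ∈ C, 0 ≤ φ z) {x y : V}
    (hy : y ∈ C) {a : ℝ} (ha : upperRatio C x y = a) : φ x ≤ a * φ y := by
  have key : ∀ t : ℝ, t • y - x ∈ C → φ x ≤ t * φ y := fun t ht => by
    have := hφ _ ht
    simp only [map_sub, map_smul, smul_eq_mul] at this
    linarith
  rcases (hφ y hy).eq_or_lt with h0 | hpos
  · have hlt : upperRatio C x y < ⊤ := by rw [ha]; exact EReal.coe_lt_top a
    simp only [upperRatio, iInf_lt_iff] at hlt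
    obtain ⟨t, ht, -⟩ := hlt
    simpa [← h0] using key t ht
  · rw [← div_le_iff₀ hpos, ← EReal.coe_le_coe_iff, ← ha]
    exact le_iInf₂ fun t ht => EReal.coe_le_coe ((div_le_iff₀ hpos).2 (key t ht))

theorem le_apply_of_lowerRatio_eq {φ : V →ₗ[ℝ] ℝ} (hφ : ∀ z ∈ C, 0 ≤ φ z) {x y : V}
    (hx : x ∈ C) (hy : y ∈ C) {b : ℝ} (hb : lowerRatio C x y = b) : b * φ y ≤ φ x := by
  rcases (hφ y hy).eq_or_lt with h0 | hpos
  · simpa [← h0] using hφ x hx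
  · rw [← le_div_iff₀ hpos, ← EReal.coe_le_coe_iff, ← hb]
    refine iSup₂_le fun t ht => EReal.coe_le_coe ((le_div_iff₀ hpos).2 ?_)
    have := hφ _ ht
    simp only [map_sub, map_smul, smul_eq_mul] at this
    linarith

/-- If a cone is cut out by a family of linear functionals, a bound on Hilbert's metric is a
bound on cross ratios. This form is symmetric in points and functionals, which is what makes
the diameter of a map comparable with that of its adjoint. -/
theorem hilbertDist_le_iff {ι : Type*} (φ : ι → V →ₗ[ℝ] ℝ) (hC : ∀ z, z ∈ C ↔ ∀ i, 0 ≤ φ i z)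
    {x y : V} (hx : x ∈ C) (hy : y ∈ C) {k : ι} (hkx : 0 < φ k x) (hky : 0 < φ k y) (r : ℝ) :
    hilbertDist C x y ≤ r ↔
      ∀ i j, φ i x * φ j y ≤ Real.exp r * (φ j x * φ i y) := by
  have hφ : ∀ i, ∀ z ∈ C, 0 ≤ φ i z := fun i z hz => (hC z).1 hz i
  have hlog : hilbertDist C x y ≤ r ↔
      (upperRatio C x y).toENNReal / (lowerRatio C x y).toENNReal
        ≤ ENNReal.ofReal (Real.exp r) := by
    rw [hilbertDist, ← ENNReal.log_le_log_iff, ENNReal.log_ofReal_of_pos (Real.exp_pos r),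
      Real.log_exp]
  rw [hlog]
  have hk : 0 < φ k x / φ k y := div_pos hkx hky
  have hM : ((φ k x / φ k y : ℝ) : EReal) ≤ upperRatio C x y := by
    refine le_iInf₂ fun t ht => EReal.coe_le_coe ((div_le_iff₀ hky).2 ?_)
    have := hφ k _ ht
    simp only [map_sub, map_smul, smul_eq_mul] at this
    linarith
  have hm : lowerRatio C x y ≤ ((φ k x / φ k y : ℝ) : EReal) := by
    refine iSup₂_le fun t ht => EReal.coe_le_coe ((le_div_iff₀ hky).2 ?_)
    have := hφ k _ ht
    simp only [map_sub, map_smul, smul_eq_mul] at this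
    linarith
  have hM0 : (0 : EReal) < upperRatio C x y := (EReal.coe_pos.2 hk).trans_le hM
  constructor
  · intro h i j
    have hm0 : (lowerRatio C x y).toENNReal ≠ 0 := by
      intro h0
      rw [h0, ENNReal.div_zero (EReal.toENNReal_ne_zero_iff.2 hM0)] at h
      exact ENNReal.ofReal_ne_top (top_le_iff.1 h)
    have hmt : lowerRatio C x y ≠ ⊤ := (hm.trans_lt (EReal.coe_lt_top _)).ne
    rw [ENNReal.div_le_iff hm0 (EReal.toENNReal_ne_top_iff.2 hmt)] at h
    have hMt : upperRatio C x y ≠ ⊤ := by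
      rw [← EReal.toENNReal_ne_top_iff]
      exact (h.trans_lt (ENNReal.mul_lt_top ENNReal.ofReal_lt_top
        (EReal.toENNReal_ne_top_iff.2 hmt).lt_top)).ne
    have hm0' : 0 < lowerRatio C x y := EReal.toENNReal_ne_zero_iff.1 hm0
    obtain ⟨a, ha⟩ : ∃ a : ℝ, upperRatio C x y = a :=
      ⟨_, (EReal.coe_toReal hMt (EReal.bot_lt_zero.trans hM0).ne').symm⟩
    obtain ⟨b, hb⟩ : ∃ b : ℝ, lowerRatio C x y = b :=
      ⟨_, (EReal.coe_toReal hmt (EReal.bot_lt_zero.trans hm0').ne').symm⟩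
    rw [ha, hb, EReal.real_coe_toENNReal, EReal.real_coe_toENNReal,
      ← ENNReal.ofReal_mul (Real.exp_pos r).le] at h
    rw [hb, EReal.coe_pos] at hm0'
    have hab : a ≤ Real.exp r * b := (ENNReal.ofReal_le_ofReal_iff (by positivity)).1 h
    have h1 := apply_le_of_upperRatio_eq (hφ i) hy ha
    have h2 := le_apply_of_lowerRatio_eq (hφ j) hx hy hb
    have hi := hφ i y hy
    have hj := hφ j y hy
    calc φ i x * φ j y ≤ (a * φ i y) * φ j y := by gcongr
      _ ≤ ((Real.exp r * b) * φ i y) * φ j y := by gcongr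
      _ = Real.exp r * ((b * φ j y) * φ i y) := by ring
      _ ≤ Real.exp r * (φ j x * φ i y) := by gcongr
  · intro h
    set K := Real.exp r with hK
    have hKpos : 0 < K := Real.exp_pos r
    -- The extremal ratio is the supremum of the quotients with nonvanishing denominator.
    set S : Set ℝ := {s | ∃ i, 0 < φ i y ∧ s = φ i x / φ i y} with hS
    have hSne : S.Nonempty := ⟨_, k, hky, rfl⟩
    have hle : ∀ j, 0 < φ j y → ∀ s ∈ S, s ≤ K * (φ j x / φ j y) := by
      rintro j hj s ⟨i, hi, rfl⟩
      rw [div_le_iff₀ hi, mul_div_assoc', div_mul_eq_mul_div, le_div_iff₀ hj]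
      linarith [h i j]
    have hbdd : BddAbove S := ⟨_, hle k hky⟩
    have ha : 0 < sSup S := hk.trans_le (le_csSup hbdd ⟨k, hky, rfl⟩)
    have h1 : upperRatio C x y ≤ (sSup S : ℝ) := by
      refine iInf₂_le (sSup S) ((hC _).2 fun i => ?_)
      simp only [map_sub, map_smul, smul_eq_mul, sub_nonneg]
      rcases (hφ i y hy).eq_or_lt with h0 | hpos
      · have := h i k
        rw [← h0] at this ⊢
        nlinarith
      · exact (div_le_iff₀ hpos).1 (le_csSup hbdd ⟨i, hpos, rfl⟩)
    have h2 : ((sSup S / K : ℝ) : EReal) ≤ lowerRatio C x y := by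
      refine le_iSup₂_of_le (sSup S / K) ((hC _).2 fun j => ?_) le_rfl
      simp only [map_sub, map_smul, smul_eq_mul, sub_nonneg]
      rcases (hφ j y hy).eq_or_lt with h0 | hpos
      · simpa [← h0] using hφ j x hx
      · rw [← le_div_iff₀ hpos, div_le_iff₀ hKpos]
        exact csSup_le hSne fun s hs => (hle j hpos s hs).trans_eq (mul_comm _ _)
    calc (upperRatio C x y).toENNReal / (lowerRatio C x y).toENNReal
        ≤ ENNReal.ofReal (sSup S) / ENNReal.ofReal (sSup S / K) :=
          ENNReal.div_le_div (EReal.toENNReal_le_toENNReal h1) (EReal.toENNReal_le_toENNReal h2)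
      _ = ENNReal.ofReal K := by
          rw [← ENNReal.ofReal_div_of_pos (by positivity)]
          congr 1
          field_simp

end Ratios

/-! ### States of a cone with unit -/

section States

variable {X : Type*} [NormedAddCommGroup X] [NormedSpace ℝ X] {C : ProperCone ℝ X} {e : X}

/-- The states of the cone `C` with unit `e`: the positive continuous functionals equal to `1`
at `e`. -/
def states (C : Set X) (e : X) : Set (StrongDual ℝ X) :=
  {μ | μ ∈ dualCone C ∧ μ e = 1}

theorem exists_add_smul_mem (he : e ∈ interior (C : Set X)) (x : X) :
    ∃ δ : ℝ, 0 < δ ∧ e + δ • x ∈ C := by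
  have hc : Filter.Tendsto (fun t : ℝ => e + t • x) (nhdsWithin 0 (Set.Ioi 0)) (nhds e) := by
    have : ContinuousAt (fun t : ℝ => e + t • x) 0 := by fun_prop
    simpa [ContinuousAt] using this.mono_left nhdsWithin_le_nhds
  obtain ⟨δ, h1, h2⟩ :=
    ((hc.eventually (mem_interior_iff_mem_nhds.1 he)).and self_mem_nhdsWithin).exists
  exact ⟨δ, h2, h1⟩

theorem apply_pos_of_mem_interior (he : e ∈ interior (C : Set X)) {μ : StrongDual ℝ X}
    (hμ : μ ∈ dualCone (C : Set X)) (h0 : μ ≠ 0) : 0 < μ e := by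
  refine (hμ e (interior_subset he)).lt_of_ne' fun hz => h0 ?_
  have h : ∀ x, 0 ≤ μ x := fun x => by
    obtain ⟨δ, hδ, hx⟩ := exists_add_smul_mem he x
    have := hμ _ hx
    simp only [map_add, map_smul, smul_eq_mul, hz, zero_add] at this
    exact nonneg_of_mul_nonneg_right this hδ
  ext x
  exact le_antisymm (by simpa using h (-x)) (h x)

/-- States detect the cone: this is where the Hahn–Banach theorem enters. -/
theorem mem_iff_forall_states (he : e ∈ interior (C : Set X)) (x : X) :
    x ∈ C ↔ ∀ μ ∈ states (C : Set X) e, 0 ≤ μ x := by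
  refine ⟨fun hx μ hμ => hμ.1 x hx, fun h => ?_⟩
  by_contra hx
  obtain ⟨f, hf, hfx⟩ := C.hyperplane_separation_point hx
  have hfe : 0 < f e := apply_pos_of_mem_interior he hf (by rintro rfl; simp at hfx)
  have := h ((f e)⁻¹ • f) ⟨fun z hz => mul_nonneg (inv_nonneg.2 hfe.le) (hf z hz),
    inv_mul_cancel₀ hfe.ne'⟩
  exact absurd this (not_le.2 (mul_neg_of_pos_of_neg (inv_pos.2 hfe) hfx))

theorem mem_iff_forall_dualCone (x : X) :
    x ∈ C ↔ ∀ μ : dualCone (C : Set X), 0 ≤ μ.1 x := by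
  refine ⟨fun hx μ => μ.2 x hx, fun h => ?_⟩
  by_contra hx
  obtain ⟨f, hf, hfx⟩ := C.hyperplane_separation_point hx
  exact absurd (h ⟨f, hf⟩) (not_le.2 hfx)

theorem states_nonempty (he : e ∈ interior (C : Set X)) (hC : -e ∉ C) :
    (states (C : Set X) e).Nonempty := by
  rw [mem_iff_forall_states he] at hC
  push Not at hC
  obtain ⟨μ, hμ, -⟩ := hC
  exact ⟨μ, hμ⟩

theorem exists_upperRatio_eq (he : e ∈ interior (C : Set X)) (hC : -e ∉ C) (x : X) :
    ∃ M : ℝ, upperRatio (C : Set X) x e = M ∧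
      ∀ t, M ≤ t ↔ ∀ μ ∈ states (C : Set X) e, μ x ≤ t := by
  obtain ⟨δ, hδ, hx⟩ := exists_add_smul_mem he (-x)
  have hbdd : BddAbove ((fun μ : StrongDual ℝ X => μ x) '' states (C : Set X) e) := by
    refine ⟨1 / δ, ?_⟩
    rintro _ ⟨μ, hμ, rfl⟩
    have := hμ.1 _ hx
    simp only [map_add, map_smul, smul_eq_mul, hμ.2, map_neg] at this
    rw [le_div_iff₀ hδ]
    linarith
  have hiff : ∀ t, sSup ((fun μ : StrongDual ℝ X => μ x) '' states (C : Set X) e) ≤ t ↔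
      ∀ μ ∈ states (C : Set X) e, μ x ≤ t := fun t => by
    rw [csSup_le_iff hbdd ((states_nonempty he hC).image _), Set.forall_mem_image]
  have hmem : ∀ t : ℝ, t • e - x ∈ C ↔ ∀ μ ∈ states (C : Set X) e, μ x ≤ t := fun t => by
    rw [mem_iff_forall_states he]
    refine forall₂_congr fun μ hμ => ?_
    simp [hμ.2]
  refine ⟨_, le_antisymm ?_ ?_, hiff⟩
  · exact iInf₂_le (sSup ((fun μ : StrongDual ℝ X => μ x) '' states (C : Set X) e))
      ((hmem _).2 ((hiff _).1 le_rfl))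
  · exact le_iInf₂ fun t ht => EReal.coe_le_coe ((hiff t).2 ((hmem t).1 ht))

theorem upperRatio_toReal_le_iff (he : e ∈ interior (C : Set X)) (hC : -e ∉ C) {x : X} {t : ℝ} :
    (upperRatio (C : Set X) x e).toReal ≤ t ↔ ∀ μ ∈ states (C : Set X) e, μ x ≤ t := by
  obtain ⟨M, hM, h⟩ := exists_upperRatio_eq he hC x
  rw [hM, EReal.toReal_coe, h]

theorem lowerRatio_eq_neg_upperRatio (x y : X) (C : Set X) :
    lowerRatio C x y = -upperRatio C (-x) y := by
  have h : ∀ t : ℝ, x - t • y ∈ C ↔ (-t) • y - -x ∈ C := fun t => by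
    rw [show (-t) • y - -x = x - t • y by module]
  refine le_antisymm (iSup₂_le fun t ht => ?_) ?_
  · rw [EReal.le_neg]
    exact iInf₂_le (-t) ((h t).1 ht)
  · rw [EReal.neg_le]
    refine le_iInf₂ fun t ht => ?_
    rw [EReal.neg_le]
    exact le_iSup₂_of_le (-t) ((h _).2 (by rwa [neg_neg])) le_rfl

theorem le_lowerRatio_toReal_iff (he : e ∈ interior (C : Set X)) (hC : -e ∉ C) {x : X} {t : ℝ} :
    t ≤ (lowerRatio (C : Set X) x e).toReal ↔ ∀ μ ∈ states (C : Set X) e, t ≤ μ x := by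
  rw [lowerRatio_eq_neg_upperRatio, EReal.toReal_neg_eq, le_neg, upperRatio_toReal_le_iff he hC]
  simp

theorem hopfSeminorm_le_iff (he : e ∈ interior (C : Set X)) (hC : -e ∉ C) {x : X} {c : ℝ} :
    hopfSeminorm (C : Set X) e x ≤ c ↔
      ∀ μ ∈ states (C : Set X) e, ∀ ν ∈ states (C : Set X) e, μ x - ν x ≤ c := by
  rw [hopfSeminorm, sub_le_iff_le_add, upperRatio_toReal_le_iff he hC]
  refine forall₂_congr fun μ _ => ?_
  rw [← sub_le_iff_le_add', le_lowerRatio_toReal_iff he hC]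
  exact forall₂_congr fun ν _ => sub_le_comm

theorem hopfSeminorm_nonneg (he : e ∈ interior (C : Set X)) (hC : -e ∉ C) (x : X) :
    0 ≤ hopfSeminorm (C : Set X) e x := by
  obtain ⟨μ, hμ⟩ := states_nonempty he hC
  simpa using (hopfSeminorm_le_iff he hC).1 le_rfl μ hμ μ hμ

theorem hopfSeminorm_smul_le (he : e ∈ interior (C : Set X)) (hC : -e ∉ C) {a : ℝ} (ha : 0 ≤ a)
    (x : X) : hopfSeminorm (C : Set X) e (a • x) ≤ a * hopfSeminorm (C : Set X) e x := by
  refine (hopfSeminorm_le_iff he hC).2 fun μ hμ ν hν => ?_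
  have := (hopfSeminorm_le_iff he hC).1 (le_refl (hopfSeminorm (C : Set X) e x)) μ hμ ν hν
  simp only [map_smul, smul_eq_mul, ← mul_sub]
  gcongr

theorem hopfSeminorm_le_two_mul_thompsonNorm (x : X) (C : Set X) :
    hopfSeminorm C e x ≤ 2 * thompsonNorm C e x := by
  have h1 := le_max_left (upperRatio C x e).toReal (-(lowerRatio C x e).toReal)
  have h2 := le_max_right (upperRatio C x e).toReal (-(lowerRatio C x e).toReal)
  simp only [hopfSeminorm, thompsonNorm]
  linarith

/-- A translate along the unit of twice a vector of Hopf seminorm at most `1` lies on the unit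
sphere of Thompson's norm: normalize the upper ratio to `1`. -/
theorem exists_thompsonNorm_two_smul_add_eq_one (he : e ∈ interior (C : Set X)) (hC : -e ∉ C)
    {x : X} (hx : hopfSeminorm (C : Set X) e x ≤ 1) :
    ∃ s : ℝ, thompsonNorm (C : Set X) e ((2 : ℝ) • x + s • e) = 1 := by
  set M := (upperRatio (C : Set X) x e).toReal with hM
  have hs : ∀ t : ℝ, (upperRatio (C : Set X) ((2 : ℝ) • x + (1 - 2 * M) • e) e).toReal ≤ t ↔
      1 ≤ t := fun t => by
    rw [upperRatio_toReal_le_iff he hC,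
      show (1 ≤ t ↔ M ≤ (t - 1) / 2 + M) by constructor <;> intro h <;> linarith, hM,
      upperRatio_toReal_le_iff he hC, ← hM]
    refine forall₂_congr fun μ hμ => ?_
    simp only [map_add, map_smul, smul_eq_mul, hμ.2]
    constructor <;> intro h <;> linarith
  refine ⟨1 - 2 * M, ?_⟩
  rw [thompsonNorm, le_antisymm ((hs 1).2 le_rfl) ((hs _).1 le_rfl), max_eq_left]
  rw [neg_le, le_lowerRatio_toReal_iff he hC]
  intro μ hμ
  have hxM : M - (lowerRatio (C : Set X) x e).toReal ≤ 1 := hx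
  have := (le_lowerRatio_toReal_iff he hC (x := x)).1 le_rfl μ hμ
  simp only [map_add, map_smul, smul_eq_mul, hμ.2]
  linarith

/-- On functionals vanishing at the unit, half of the dual Thompson norm is the norm dual to
Hopf's seminorm. -/
theorem dualHopfNorm_eq_iSup (he : e ∈ interior (C : Set X)) (hC : -e ∉ C)
    {μ : StrongDual ℝ X} (hμ : μ e = 0) :
    dualHopfNorm (C : Set X) e μ =
      ⨆ (x : X) (_ : hopfSeminorm (C : Set X) e x ≤ 1), ((μ x : ℝ) : EReal) := by
  have h2 : (0 : EReal) < 2 := by norm_num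
  have h2t : (2 : EReal) ≠ ⊤ := EReal.coe_ne_top 2
  apply le_antisymm
  · rw [dualHopfNorm, EReal.div_le_iff_le_mul h2 h2t]
    refine iSup₂_le fun x hx => ?_
    have hx' : hopfSeminorm (C : Set X) e ((2⁻¹ : ℝ) • x) ≤ 1 := by
      have h1 := hopfSeminorm_smul_le he hC (by norm_num : (0 : ℝ) ≤ 2⁻¹) x
      have h3 := hopfSeminorm_le_two_mul_thompsonNorm (e := e) x (C : Set X)
      rw [hx] at h3
      linarith
    have heq : ((μ x : ℝ) : EReal) = 2 * ((μ ((2⁻¹ : ℝ) • x) : ℝ) : EReal) := by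
      rw [show (2 : EReal) = ((2 : ℝ) : EReal) from rfl, ← EReal.coe_mul]
      simp
    rw [heq]
    exact mul_le_mul_of_nonneg_left
      (le_iSup₂ (f := fun (x : X) (_ : hopfSeminorm (C : Set X) e x ≤ 1) =>
        ((μ x : ℝ) : EReal)) _ hx') h2.le
  · refine iSup₂_le fun x hx => ?_
    obtain ⟨s, hs⟩ := exists_thompsonNorm_two_smul_add_eq_one he hC hx
    rw [dualHopfNorm, EReal.le_div_iff_mul_le h2 h2t]
    refine le_iSup₂_of_le _ hs ?_
    rw [show (2 : EReal) = ((2 : ℝ) : EReal) from rfl, ← EReal.coe_mul]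
    simp [hμ, mul_comm]

theorem apply_le_hopfSeminorm (he : e ∈ interior (C : Set X)) (hC : -e ∉ C)
    {μ : StrongDual ℝ X} (hμ : μ e = 0) (h : dualHopfNorm (C : Set X) e μ ≤ 1) (x : X) :
    μ x ≤ hopfSeminorm (C : Set X) e x := by
  rw [dualHopfNorm_eq_iSup he hC hμ] at h
  -- The seminorm may vanish at `x`, so `x` is rescaled by a number slightly above it.
  refine le_of_forall_gt_imp_ge_of_dense fun a ha => ?_
  have ha0 : 0 < a := (hopfSeminorm_nonneg he hC x).trans_lt ha
  have h1 : hopfSeminorm (C : Set X) e (a⁻¹ • x) ≤ 1 := by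
    refine (hopfSeminorm_smul_le he hC (inv_nonneg.2 ha0.le) x).trans ?_
    rw [inv_mul_le_iff₀ ha0]
    linarith
  have h3 := (le_iSup₂ (f := fun (x : X) (_ : hopfSeminorm (C : Set X) e x ≤ 1) =>
    ((μ x : ℝ) : EReal)) _ h1).trans h
  have h4 : μ (a⁻¹ • x) ≤ 1 := by exact_mod_cast h3
  rw [map_smul, smul_eq_mul, inv_mul_le_iff₀ ha0] at h4
  linarith

theorem dualHopfNorm_sub_le_one (he : e ∈ interior (C : Set X)) (hC : -e ∉ C)
    {μ ν : StrongDual ℝ X} (hμ : μ ∈ states (C : Set X) e) (hν : ν ∈ states (C : Set X) e) :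
    dualHopfNorm (C : Set X) e (μ - ν) ≤ 1 := by
  rw [dualHopfNorm_eq_iSup he hC (by simp [hμ.2, hν.2])]
  refine iSup₂_le fun x hx => ?_
  have := (hopfSeminorm_le_iff he hC).1 hx μ hμ ν hν
  exact_mod_cast this

end States

/-! ### The operator and its adjoint -/

section Operator

variable {X : Type*} [NormedAddCommGroup X] [NormedSpace ℝ X]
variable {Y : Type*} [NormedAddCommGroup Y] [NormedSpace ℝ Y]
variable {C : ProperCone ℝ X} {D : ProperCone ℝ Y} {e : X} {f : Y} {T : X →L[ℝ] Y}

/-- Both operator norms are the supremum of `μ (T x)` over the two unit balls. -/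
theorem dualHopfOpNorm_eq_hopfOpNorm (he : e ∈ interior (C : Set X)) (hC : -e ∉ C)
    (hf : f ∈ interior (D : Set Y)) (hD : -f ∉ D) {lam : ℝ} (hT : T e = lam • f) :
    dualHopfOpNorm (C : Set X) e (D : Set Y) f T = hopfOpNorm (C : Set X) e (D : Set Y) f T := by
  have hadj : ∀ μ : StrongDual ℝ Y, μ f = 0 → dualHopfNorm (C : Set X) e (adjointMap T μ) =
      ⨆ (x : X) (_ : hopfSeminorm (C : Set X) e x ≤ 1), ((μ (T x) : ℝ) : EReal) := fun μ hμ =>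
    dualHopfNorm_eq_iSup he hC (by simp [adjointMap, hT, hμ])
  apply le_antisymm
  · refine iSup₂_le fun μ hμ => ?_
    rw [hadj μ hμ.1]
    exact iSup₂_mono fun x _ =>
      EReal.coe_le_coe (apply_le_hopfSeminorm hf hD hμ.1 hμ.2 (T x))
  · refine iSup₂_le fun x hx => ?_
    by_contra hlt
    obtain ⟨c, hc1, hc2⟩ := EReal.lt_iff_exists_real_btwn.1 (not_le.1 hlt)
    -- Two states between which `T x` oscillates by more than `c` give a dual unit vector.
    have hc : ¬ hopfSeminorm (D : Set Y) f (T x) ≤ c := not_le.2 (EReal.coe_lt_coe_iff.1 hc2)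
    rw [hopfSeminorm_le_iff hf hD] at hc
    push Not at hc
    obtain ⟨μ, hμ, ν, hν, hμν⟩ := hc
    have h0 : (μ - ν) f = 0 := by simp [hμ.2, hν.2]
    have h1 : ((c : ℝ) : EReal) ≤ dualHopfOpNorm (C : Set X) e (D : Set Y) f T := by
      refine le_iSup₂_of_le (μ - ν) ⟨h0, dualHopfNorm_sub_le_one hf hD hμ hν⟩ ?_
      rw [hadj _ h0]
      exact le_iSup₂_of_le x hx (EReal.coe_le_coe (by simpa using hμν.le))
    exact absurd hc1 (not_lt.2 h1)

theorem map_mem_of_map_interior (he : e ∈ interior (C : Set X))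
    (hT : ∀ x ∈ interior (C : Set X), T x ∈ interior (D : Set Y)) : ∀ x ∈ C, T x ∈ D := by
  have hsub : interior (C : Set X) ⊆ T ⁻¹' (D : Set Y) := fun x hx =>
    interior_subset (s := (D : Set Y)) (hT x hx)
  have hcl := (D.isClosed.preimage T.continuous).closure_subset_iff.2 hsub
  rw [C.convex.closure_interior_eq_closure_of_nonempty_interior ⟨e, he⟩,
    C.isClosed.closure_eq] at hcl
  exact fun x hx => hcl hx

/-- All cross ratios of `T` between two points of `C` and two positive functionals on `D` are at
most `K`. -/
def CrossRatioBound (C : Set X) (D : Set Y) (T : X →L[ℝ] Y) (K : ℝ) : Prop :=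
  ∀ u ∈ dualCone D, ∀ v ∈ dualCone D, ∀ x ∈ C, ∀ y ∈ C,
    u (T x) * v (T y) ≤ K * (v (T x) * u (T y))

theorem projDiam_le_iff (he : e ∈ interior (C : Set X)) (hf : f ∈ interior (D : Set Y))
    (hD : -f ∉ D) (hT : ∀ x ∈ interior (C : Set X), T x ∈ interior (D : Set Y)) (r : ℝ) :
    projDiam (C : Set X) (D : Set Y) T ≤ r ↔
      CrossRatioBound (C : Set X) (D : Set Y) T (Real.exp r) := by
  obtain ⟨ν, hν⟩ := states_nonempty hf hD
  have hν0 : ν ≠ 0 := by rintro rfl; simpa using hν.2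
  have hd : ∀ x ∈ interior (C : Set X), ∀ y ∈ interior (C : Set X),
      (hilbertDist (D : Set Y) (T x) (T y) ≤ r ↔ ∀ u v : dualCone (D : Set Y),
        u.1 (T x) * v.1 (T y) ≤ Real.exp r * (v.1 (T x) * u.1 (T y))) := fun x hx y hy =>
    hilbertDist_le_iff (fun μ : dualCone (D : Set Y) => (μ.1 : Y →ₗ[ℝ] ℝ))
      mem_iff_forall_dualCone (interior_subset (hT x hx)) (interior_subset (hT y hy))
      (k := ⟨ν, hν.1⟩) (apply_pos_of_mem_interior (hT x hx) hν.1 hν0)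
      (apply_pos_of_mem_interior (hT y hy) hν.1 hν0) r
  simp only [projDiam, iSup_le_iff]
  constructor
  · intro h u hu v hv x hx y hy
    -- The inequality passes from the interior of the cone to its closure.
    have hcl : IsClosed {p : X × X |
        u (T p.1) * v (T p.2) ≤ Real.exp r * (v (T p.1) * u (T p.2))} :=
      isClosed_le (by fun_prop) (by fun_prop)
    have hsub : interior (C : Set X) ×ˢ interior (C : Set X) ⊆ {p : X × X |
        u (T p.1) * v (T p.2) ≤ Real.exp r * (v (T p.1) * u (T p.2))} := fun p hp =>
      (hd p.1 hp.1 p.2 hp.2).1 (h p.1 hp.1 p.2 hp.2) ⟨u, hu⟩ ⟨v, hv⟩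
    have hC' : closure (interior (C : Set X)) = C := by
      rw [C.convex.closure_interior_eq_closure_of_nonempty_interior ⟨e, he⟩, C.isClosed.closure_eq]
    have := hcl.closure_subset_iff.2 hsub
    rw [closure_prod_eq, hC'] at this
    exact this (Set.mk_mem_prod hx hy)
  · intro h x hx y hy
    exact (hd x hx y hy).2 fun u v => h u u.2 v v.2 x (interior_subset hx) y (interior_subset hy)

theorem dualProjDiam_le_iff (he : e ∈ interior (C : Set X))
    (hT : ∀ x ∈ interior (C : Set X), T x ∈ interior (D : Set Y)) (r : ℝ) :
    dualProjDiam (C : Set X) (D : Set Y) T ≤ r ↔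
      CrossRatioBound (C : Set X) (D : Set Y) T (Real.exp r) := by
  have hTC : ∀ x ∈ C, T x ∈ D := map_mem_of_map_interior he hT
  have hadj : ∀ u ∈ dualCone (D : Set Y), adjointMap T u ∈ dualCone (C : Set X) :=
    fun u hu x hx => hu _ (hTC x hx)
  have hd : ∀ u ∈ dualCone (D : Set Y) \ {0}, ∀ v ∈ dualCone (D : Set Y) \ {0},
      (hilbertDist (dualCone (C : Set X)) (adjointMap T u) (adjointMap T v) ≤ r ↔ ∀ x y : C,
        u (T x) * v (T y) ≤ Real.exp r * (u (T y) * v (T x))) := fun u hu v hv =>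
    hilbertDist_le_iff
      (fun x : C => (ContinuousLinearMap.apply ℝ ℝ (x : X) : StrongDual ℝ X →ₗ[ℝ] ℝ))
      (fun μ => ⟨fun (h : μ ∈ dualCone (C : Set X)) x => h x x.2, fun h x hx => h ⟨x, hx⟩⟩)
      (hadj u hu.1) (hadj v hv.1)
      (k := ⟨e, interior_subset he⟩)
      (apply_pos_of_mem_interior (hT e he) hu.1 hu.2)
      (apply_pos_of_mem_interior (hT e he) hv.1 hv.2) r
  simp only [dualProjDiam, iSup_le_iff]
  constructor
  · intro h u hu v hv x hx y hy
    by_cases hu0 : u = 0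
    · simp [hu0]
    by_cases hv0 : v = 0
    · simp [hv0]
    rw [mul_comm (v (T x))]
    exact (hd u ⟨hu, hu0⟩ v ⟨hv, hv0⟩).1 (h u ⟨hu, hu0⟩ v ⟨hv, hv0⟩) ⟨x, hx⟩ ⟨y, hy⟩
  · intro h u hu v hv
    refine (hd u hu v hv).2 fun x y => ?_
    rw [mul_comm (u (T y))]
    exact h u hu.1 v hv.1 x x.2 y y.2

/-- The projective diameters of a positive map and of its adjoint agree. -/
theorem projDiam_eq_dualProjDiam (he : e ∈ interior (C : Set X)) (hf : f ∈ interior (D : Set Y))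
    (hD : -f ∉ D) (hT : ∀ x ∈ interior (C : Set X), T x ∈ interior (D : Set Y)) :
    projDiam (C : Set X) (D : Set Y) T = dualProjDiam (C : Set X) (D : Set Y) T := by
  apply le_antisymm <;> refine EReal.le_of_forall_lt_iff_le.1 fun r hr => ?_
  · exact (projDiam_le_iff he hf hD hT r).2 ((dualProjDiam_le_iff he hT r).1 hr.le)
  · exact (dualProjDiam_le_iff he hT r).2 ((projDiam_le_iff he hf hD hT r).1 hr.le)

end Operator

/-! ### The contraction bound -/

/-- The scalar inequality behind Hopf's bound: with `p = √(s (1 - t))` and `q = √(t (1 - s))`,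
the Cauchy–Schwarz inequality gives `p + q ≤ 1`, and `s - t = p ^ 2 - q ^ 2`. -/
theorem sub_le_tanh_of_crossRatio {s t r : ℝ} (hr : 0 ≤ r) (hs0 : 0 ≤ s) (hs1 : s ≤ 1)
    (ht0 : 0 ≤ t) (ht1 : t ≤ 1) (h : s * (1 - t) ≤ Real.exp r * (t * (1 - s))) :
    s - t ≤ Real.tanh (r / 4) := by
  set E := Real.exp (r / 4) with hE
  set F := Real.exp (-(r / 4)) with hF
  have hE0 : 0 < E := Real.exp_pos _
  have hF0 : 0 < F := Real.exp_pos _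
  have hEF : E * F = 1 := by rw [hE, hF, ← Real.exp_add]; simp
  have hFE : F ≤ E := Real.exp_le_exp.2 (by linarith)
  have hr4 : Real.exp r = (E ^ 2) ^ 2 := by
    rw [hE, ← Real.exp_nat_mul, ← Real.exp_nat_mul]
    congr 1
    push_cast
    ring
  have hA : 0 ≤ s * (1 - t) := mul_nonneg hs0 (by linarith)
  have hB : 0 ≤ t * (1 - s) := mul_nonneg ht0 (by linarith)
  obtain ⟨p, hp0, hp⟩ : ∃ p : ℝ, 0 ≤ p ∧ p ^ 2 = s * (1 - t) :=
    ⟨_, Real.sqrt_nonneg _, Real.sq_sqrt hA⟩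
  obtain ⟨q, hq0, hq⟩ : ∃ q : ℝ, 0 ≤ q ∧ q ^ 2 = t * (1 - s) :=
    ⟨_, Real.sqrt_nonneg _, Real.sq_sqrt hB⟩
  have hpq : p ≤ E ^ 2 * q := by
    refine le_of_sq_le_sq ?_ (by positivity)
    rw [mul_pow, hp, hq, ← hr4]
    exact h
  have hsum : p + q ≤ 1 := by
    have h1 : 2 * (p * q) ≤ s * t + (1 - s) * (1 - t) := by
      have h2 : (p * q) ^ 2 = (s * t) * ((1 - s) * (1 - t)) := by
        rw [mul_pow, hp, hq]; ring
      have h3 : 0 ≤ s * t + (1 - s) * (1 - t) :=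
        add_nonneg (mul_nonneg hs0 ht0) (mul_nonneg (by linarith) (by linarith))
      refine le_of_sq_le_sq ?_ h3
      nlinarith [sq_nonneg (s * t - (1 - s) * (1 - t))]
    refine le_of_sq_le_sq ?_ zero_le_one
    nlinarith
  rw [Real.tanh_eq, ← hE, ← hF, le_div_iff₀ (by positivity)]
  have hst : s - t = (p - q) * (p + q) := by linear_combination hq - hp
  have hpF : p * F ≤ E * q := by
    calc p * F ≤ E ^ 2 * q * F := by gcongr
      _ = E * q * (E * F) := by ring
      _ = E * q := by rw [hEF, mul_one]
  have hdiff : (p - q) * (E + F) ≤ (E - F) * (p + q) := by linarith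
  have hsum0 : 0 ≤ p + q := add_nonneg hp0 hq0
  calc (s - t) * (E + F) = ((p - q) * (E + F)) * (p + q) := by rw [hst]; ring
    _ ≤ ((E - F) * (p + q)) * (p + q) := by gcongr
    _ ≤ ((E - F) * 1) * 1 := by
        have : 0 ≤ E - F := sub_nonneg.2 hFE
        gcongr
    _ = E - F := by ring

section Contraction

variable {X : Type*} [NormedAddCommGroup X] [NormedSpace ℝ X]
variable {Y : Type*} [NormedAddCommGroup Y] [NormedSpace ℝ Y]
variable {C : ProperCone ℝ X} {D : ProperCone ℝ Y} {e : X} {f : Y} {T : X →L[ℝ] Y}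

theorem zero_notMem_interior [Nontrivial X] (hp : ∀ x ∈ C, -x ∈ C → x = 0) :
    (0 : X) ∉ interior (C : Set X) := by
  intro h0
  have hall : ∀ x : X, x ∈ C := fun x => by
    obtain ⟨δ, hδ, hx⟩ := exists_add_smul_mem h0 x
    rw [zero_add] at hx
    simpa [smul_smul, hδ.ne'] using C.smul_mem hx (inv_nonneg.2 hδ.le)
  obtain ⟨x, hx⟩ := exists_ne (0 : X)
  exact hx (hp x (hall x) (hall (-x)))

/-- Between two states, the image of a point of the order interval `[0, e]` oscillates by at most
`lam * tanh (diam T / 4)`: the cross ratio bound is applied to `z` and `e - z`. -/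
theorem sub_le_mul_tanhExt_projDiam (he : e ∈ interior (C : Set X))
    (hf : f ∈ interior (D : Set Y)) (hD : -f ∉ D)
    (hT : ∀ x ∈ interior (C : Set X), T x ∈ interior (D : Set Y))
    {lam : ℝ} (hlam : 0 < lam) (hTe : T e = lam • f) {z : X} (hz : z ∈ C) (hz' : e - z ∈ C)
    {μ ν : StrongDual ℝ Y} (hμ : μ ∈ states (D : Set Y) f) (hν : ν ∈ states (D : Set Y) f) :
    μ (T z) - ν (T z) ≤ lam * tanhExt (projDiam (C : Set X) (D : Set Y) T / 4) := by
  have hTC : ∀ x ∈ C, T x ∈ D := map_mem_of_map_interior he hT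
  have heq : ∀ ξ ∈ states (D : Set Y) f, ξ (T (e - z)) = lam - ξ (T z) := fun ξ hξ => by
    simp [hTe, hξ.2]
  have hpos : ∀ ξ ∈ states (D : Set Y) f, 0 ≤ ξ (T z) / lam ∧ ξ (T z) / lam ≤ 1 := fun ξ hξ => by
    have h1 := hξ.1 _ (hTC z hz)
    have h2 := hξ.1 _ (hTC _ hz')
    rw [heq ξ hξ] at h2
    exact ⟨div_nonneg h1 hlam.le, (div_le_one hlam).2 (by linarith)⟩
  have hr0 : ∀ r : ℝ, projDiam (C : Set X) (D : Set Y) T ≤ r → 0 ≤ r := fun r hr => by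
    have h := (projDiam_le_iff he hf hD hT r).1 hr μ hμ.1 μ hμ.1 e (interior_subset he) e
      (interior_subset he)
    have h1 : μ (T e) = lam := by simp [hTe, hμ.2]
    rw [h1] at h
    exact Real.one_le_exp_iff.1 ((le_mul_iff_one_le_left (by positivity)).1 h)
  suffices h : μ (T z) / lam - ν (T z) / lam
      ≤ tanhExt (projDiam (C : Set X) (D : Set Y) T / 4) by
    rwa [← sub_div, div_le_iff₀' hlam] at h
  induction hΔ : projDiam (C : Set X) (D : Set Y) T with
  | bot => exact absurd (hr0 (-1) (by simp [hΔ])) (by norm_num)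
  | top =>
    have h4 : (⊤ : EReal) / 4 = ⊤ :=
      EReal.top_div_of_pos_ne_top (by norm_num) (EReal.coe_ne_top 4)
    rw [h4, tanhExt, if_pos rfl]
    linarith [(hpos μ hμ).2, (hpos ν hν).1]
  | coe r =>
    have h := (projDiam_le_iff he hf hD hT r).1 hΔ.le μ hμ.1 ν hν.1 z hz (e - z) hz'
    rw [heq μ hμ, heq ν hν] at h
    rw [show (r : EReal) / 4 = ((r / 4 : ℝ) : EReal) from rfl, tanhExt,
      if_neg (EReal.coe_ne_top _), if_neg (EReal.coe_ne_bot _), EReal.toReal_coe]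
    refine sub_le_tanh_of_crossRatio (hr0 r hΔ.le) (hpos μ hμ).1 (hpos μ hμ).2 (hpos ν hν).1
      (hpos ν hν).2 ?_
    field_simp
    linarith

theorem hopfOpNorm_le_mul_tanhExt (he : e ∈ interior (C : Set X)) (hC : -e ∉ C)
    (hf : f ∈ interior (D : Set Y)) (hD : -f ∉ D)
    (hT : ∀ x ∈ interior (C : Set X), T x ∈ interior (D : Set Y))
    {lam : ℝ} (hlam : 0 < lam) (hTe : T e = lam • f) :
    hopfOpNorm (C : Set X) e (D : Set Y) f T
      ≤ ((lam * tanhExt (projDiam (C : Set X) (D : Set Y) T / 4) : ℝ) : EReal) := by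
  refine iSup₂_le fun x hx => EReal.coe_le_coe ((hopfSeminorm_le_iff hf hD).2 fun μ hμ ν hν => ?_)
  -- Translation along the unit moves `x` into the order interval `[0, e]`.
  set m := (lowerRatio (C : Set X) x e).toReal with hm
  have hz : x - m • e ∈ C := by
    rw [mem_iff_forall_states he]
    intro ξ hξ
    have := (le_lowerRatio_toReal_iff he hC (x := x)).1 le_rfl ξ hξ
    simp only [map_sub, map_smul, smul_eq_mul, hξ.2]
    linarith
  have hz' : e - (x - m • e) ∈ C := by
    rw [mem_iff_forall_states he]
    intro ξ hξ
    have hM : (upperRatio (C : Set X) x e).toReal - m ≤ 1 := hx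
    have := (upperRatio_toReal_le_iff he hC (x := x)).1 le_rfl ξ hξ
    simp only [map_sub, map_smul, smul_eq_mul, hξ.2]
    linarith
  have h := sub_le_mul_tanhExt_projDiam he hf hD hT hlam hTe hz hz' hμ hν
  simpa [hTe, hμ.2, hν.2] using h

end Contraction

end HopfContraction

theorem mainTheorem10
    {X₁ : Type*} [NormedAddCommGroup X₁] [NormedSpace ℝ X₁] [CompleteSpace X₁]
    {X₂ : Type*} [NormedAddCommGroup X₂] [NormedSpace ℝ X₂] [CompleteSpace X₂] [Nontrivial X₂]
    (C₁ : ProperCone ℝ X₁) (C₂ : ProperCone ℝ X₂)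
    (hpointed₁ : ∀ x ∈ C₁, -x ∈ C₁ → x = 0) (hpointed₂ : ∀ x ∈ C₂, -x ∈ C₂ → x = 0)
    (hnormal₁ : HopfContraction.IsNormalCone (C₁ : Set X₁))
    (hnormal₂ : HopfContraction.IsNormalCone (C₂ : Set X₂))
    (e₁ : X₁) (he₁ : e₁ ∈ interior (C₁ : Set X₁))
    (e₂ : X₂) (he₂ : e₂ ∈ interior (C₂ : Set X₂))
    (T : X₁ →L[ℝ] X₂) (lam : ℝ) (hlam : T e₁ = lam • e₂)
    (hT : ∀ x ∈ interior (C₁ : Set X₁), T x ∈ interior (C₂ : Set X₂)) :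
    HopfContraction.dualHopfOpNorm (C₁ : Set X₁) e₁ (C₂ : Set X₂) e₂ T
        = HopfContraction.hopfOpNorm (C₁ : Set X₁) e₁ (C₂ : Set X₂) e₂ T ∧
      HopfContraction.hopfOpNorm (C₁ : Set X₁) e₁ (C₂ : Set X₂) e₂ T
        ≤ ((lam * HopfContraction.tanhExt
            (HopfContraction.projDiam (C₁ : Set X₁) (C₂ : Set X₂) T / 4) : ℝ) : EReal) ∧
      HopfContraction.tanhExt (HopfContraction.projDiam (C₁ : Set X₁) (C₂ : Set X₂) T / 4)
        = HopfContraction.tanhExt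
            (HopfContraction.dualProjDiam (C₁ : Set X₁) (C₂ : Set X₂) T / 4) := by
  have h0 := HopfContraction.zero_notMem_interior hpointed₂
  have hC₂ : -e₂ ∉ C₂ := fun h => h0 (hpointed₂ e₂ (interior_subset he₂) h ▸ he₂)
  have hC₁ : -e₁ ∉ C₁ := fun h => by
    have hz := hpointed₁ e₁ (interior_subset he₁) h
    have hT0 := hT e₁ he₁
    rw [hz, map_zero] at hT0
    exact h0 hT0
  obtain ⟨ν, hν⟩ := HopfContraction.states_nonempty he₂ hC₂
  have hlam0 : 0 < lam := by
    have h := HopfContraction.apply_pos_of_mem_interior (hT e₁ he₁) hν.1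
      (by rintro rfl; simpa using hν.2)
    simpa [hlam, hν.2] using h
  exact ⟨HopfContraction.dualHopfOpNorm_eq_hopfOpNorm he₁ hC₁ he₂ hC₂ hlam,
    HopfContraction.hopfOpNorm_le_mul_tanhExt he₁ hC₁ he₂ hC₂ hT hlam0 hlam,
    by rw [HopfContraction.projDiam_eq_dualProjDiam he₁ he₂ hC₂ hT]⟩
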